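/- Let $p$ be an odd prime and let $m\ge 2$, $n\ge 1$, $1\le r\le\min\{n,m-1\}$ be integers. Let \[ G=\langle x,y : x^{p^m}=1,\ y^{p^n}=1,\ yxy^{-1}=x^{1+p^{m-r}}\rangle . \] Let $u$ be an integer that generates the group of units modulo $p^m$, and let $\alpha,\beta,\delta\in\mathrm{Aut}(G)$ be given by \[ \alpha(x)=x^u,\ \alpha(y)=y;\qquad \beta(x)=x,\ \beta(y)=x^{p^{\max\{m-n,0\}}}y;\qquad \delta(x)=x,\ \delta(y)=y^{1+p^r}. \] Put \[ \widetilde\alpha=\alpha^{(p-1)p^{m-r-1}},\quad \widetilde\beta=\beta^{p^{\min\{m,n\}-r}},\quad \widetilde\delta=\delta^{p^{\max\{n-2r,0\}}},\quad \widetilde u=u^{(p-1)p^{m-r-1}},\quad \widetilde v=(1+p^r)^{p^{\max\{n-2r,0\}}} . \] Powers of $\widetilde u$ and $\widetilde v$ with negative exponents are taken modulo the relevant power of $p$. A triplet $(a,b,d)\in\mathbb Z^3$ is called admissible if the assignments $\Gamma(x)=\widetilde\beta^{\,b}$, $\Gamma(y)=\widetilde\alpha^{\,a}\widetilde\delta^{\,d}$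 extend to a map $\Gamma:G\to\mathrm{Aut}(G)$ with $\Gamma(\sigma\tau)=\Gamma(\tau)\Gamma(\sigma)$ and $\Gamma(\varphi(\sigma))=\varphi\Gamma(\sigma)\varphi^{-1}$ for all $\sigma,\tau\in G$ and $\varphi\in\mathrm{Aut}(G)$. Triplets are counted modulo $\mathbb M=p^r\mathbb Z\times p^r\mathbb Z\times p^{\min\{r,n-r\}}\mathbb Z$. The triplet satisfies the isomorphism criterion if \[ \widetilde u^{\,a}(1+(1-b)p^{m-r})\not\equiv 1 \pmod{p^{m-r+1}} . \tag{1}\] When (1) holds, $j_{a,b,d}$ denotes any non-negative integer coprime to $p$ with \[ (\widetilde u^{\,a}(1+(1-b)p^{m-r}))^{j_{a,b,d}}\equiv 1+p^{m-r}\pmod{p^m}. \] With $\rho(\sigma)=(\tau\mapsto\tau\sigma^{-1})$, $\Phi_x=\rho(x)\widetilde\beta^{\,b}$ and $\Phi_y=\rho(y)\widetilde\alpha^{\,a}\widetilde\delta^{\,d}$, let $\pi_{a,b,d}:G\to G$ be given by \[ \pi_{a,b,d}(x^iy^j)=(\Phi_x^{\,i}\,\Phi_y^{\,j_{a,b,d}\,j})(1)\qquad(i,j\in\mathbb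 Z). \] For $v\in\mathbb Z$ with $v\equiv1\pmod p$, let $\pi'_v:G\to G$ be given by $\pi'_v(x^iy^j)=x^iy^{S(v,j)}$ for $i\in\mathbb Z$, $j\ge0$, where $S(v,j)=1+v+\cdots+v^{j-1}$. Let $\iota:G\to G$ be $\iota(g)=g^{-1}$. For bijections $f,g:G\to G$ write $f\equiv g\pmod{\mathrm{Aut}(G)}$ if $f=g\circ\varphi$ for some $\varphi\in\mathrm{Aut}(G)$. **Proposition.** Suppose that $m\le n$. Then the number of admissible triplets $(a,0,d)$ modulo $\mathbb M$ with $\widetilde v^{\,d}\equiv1\pmod{p^m}$ is equal to $p^{\min\{r,n-m\}}$. Every admissible triplet $(a,0,d)$ with $\widetilde v^{\,d}\equiv1\pmod{p^m}$ satisfies (1), and an exponent $j_{a,0,d}$ as above exists. For every choice of $j_{a,0,d}$, and for every integer $v$ with $v\equiv\widetilde v^{\,d}\pmod{p^n}$ (for $d\ge0$ one may take $v=\widetilde v^{\,d}$), the maps $\pi_{a,0,d}$ and $\pi'_{v}$ are well-defined bijections and \[ \iota\circ\pi_{a,0,d}\equiv\pi'_{v}\pmod{\mathrm{Aut}(G)}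 . \] -/

import Mathlib

/-- `geomS z l = 1 + z + ⋯ + z ^ (l - 1)`, with `geomS z 0 = 0`. -/
def geomS (z : ℤ) (l : ℕ) : ℤ := ∑ k ∈ Finset.range l, z ^ k

/-- The residue class modulo `N` of the power `z ^ e` with an arbitrary integer exponent `e`. It is
only used for `z` coprime to `N`, in which case `(z : ZMod N)⁻¹` is the inverse of `z` mod `N`. -/
def zpowMod (N : ℕ) (z : ℤ) : ℤ → ZMod N
  | .ofNat k => (z : ZMod N) ^ k
  | .negSucc k => ((z : ZMod N)⁻¹) ^ (k + 1)

/-- The numerical data: an odd prime `p`, the parameters `m, n, r`, and a fixed integer `u`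
which generates the group of units modulo `p ^ m`. -/
structure MetacyclicData where
  p : ℕ
  m : ℕ
  n : ℕ
  r : ℕ
  u : ℤ
  prime_p : p.Prime
  odd_p : Odd p
  two_le_m : 2 ≤ m
  one_le_n : 1 ≤ n
  one_le_r : 1 ≤ r
  r_le : r ≤ min n (m - 1)
  u_gen : ∃ w : (ZMod (p ^ m))ˣ, (w : ZMod (p ^ m)) = (u : ZMod (p ^ m)) ∧
    ∀ z : (ZMod (p ^ m))ˣ, z ∈ Subgroup.zpowers w

namespace MetacyclicData

variable (D : MetacyclicData)

/-- The relators of `⟨x, y : x ^ (p ^ m) = 1, y ^ (p ^ n) = 1, y x y⁻¹ = x ^ (1 + p ^ (m - r))⟩`,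
where `x` is the generator with index `0` and `y` the one with index `1`. -/
def rels : Set (FreeGroup (Fin 2)) :=
  {FreeGroup.of 0 ^ D.p ^ D.m, FreeGroup.of 1 ^ D.p ^ D.n,
    FreeGroup.of 1 * FreeGroup.of 0 * (FreeGroup.of 1)⁻¹ *
      (FreeGroup.of 0 ^ (1 + D.p ^ (D.m - D.r)))⁻¹}

/-- The split metacyclic `p`-group `G`, given by its presentation. -/
abbrev G : Type := PresentedGroup D.rels

/-- The generator `x` of `G`. -/
def x : D.G := PresentedGroup.of 0

/-- The generator `y` of `G`. -/
def y : D.G := PresentedGroup.of 1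

/-! ### Relations and homomorphisms -/

lemma x_pow : D.x ^ D.p ^ D.m = 1 := by
  have h : FreeGroup.of (0 : Fin 2) ^ D.p ^ D.m ∈ D.rels := by simp [rels]
  have h2 := PresentedGroup.one_of_mem h
  rwa [map_pow] at h2

lemma y_pow : D.y ^ D.p ^ D.n = 1 := by
  have h : FreeGroup.of (1 : Fin 2) ^ D.p ^ D.n ∈ D.rels := by simp [rels]
  have h2 := PresentedGroup.one_of_mem h
  rwa [map_pow] at h2

lemma y_x : D.y * D.x * D.y⁻¹ = D.x ^ (1 + D.p ^ (D.m - D.r)) := by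
  have h : FreeGroup.of (1 : Fin 2) * FreeGroup.of 0 * (FreeGroup.of 1)⁻¹ *
      (FreeGroup.of 0 ^ (1 + D.p ^ (D.m - D.r)))⁻¹ ∈ D.rels := by simp [rels]
  have h2 := PresentedGroup.one_of_mem h
  simp only [map_mul, map_inv, map_pow] at h2
  exact mul_inv_eq_one.mp h2

/-- The endomorphism of `G` with `x ↦ X` and `y ↦ Y`, for `X`, `Y` that satisfy the relations. -/
def homOf (X Y : D.G) (h1 : X ^ D.p ^ D.m = 1) (h2 : Y ^ D.p ^ D.n = 1)
    (h3 : Y * X * Y⁻¹ = X ^ (1 + D.p ^ (D.m - D.r))) : D.G →* D.G :=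
  PresentedGroup.toGroup (f := ![X, Y]) (by
    intro s hs
    simp only [rels, Set.mem_insert_iff, Set.mem_singleton_iff] at hs
    rcases hs with rfl | rfl | rfl
    · simpa using h1
    · simpa using h2
    · simp only [map_mul, map_inv, map_pow, FreeGroup.lift_apply_of]
      exact mul_inv_eq_one.mpr h3)

lemma homOf_x (X Y : D.G) (h1 h2 h3) : D.homOf X Y h1 h2 h3 D.x = X := by
  simp [homOf, x]

lemma homOf_y (X Y : D.G) (h1 h2 h3) : D.homOf X Y h1 h2 h3 D.y = Y := by
  simp [homOf, y]

lemma hom_ext {f g : D.G →* D.G} (hx : f D.x = g D.x) (hy : f D.y = g D.y) : f = g := by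
  apply PresentedGroup.ext
  intro i
  fin_cases i
  · exact hx
  · exact hy

lemma zpow_x_eq {a b : ℤ} (h : ((D.p : ℤ) ^ D.m) ∣ a - b) : D.x ^ a = D.x ^ b := by
  obtain ⟨c, hc⟩ := h
  have : a = b + (D.p ^ D.m : ℕ) * c := by push_cast; linarith
  rw [this, zpow_add, zpow_mul, zpow_natCast, x_pow, one_zpow, mul_one]

lemma pow_y_eq {a b : ℕ} (h : a ≡ b [MOD D.p ^ D.n]) : D.y ^ a = D.y ^ b :=
  pow_eq_pow_iff_modEq.mpr (h.of_dvd (orderOf_dvd_of_pow_eq_one D.y_pow))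

lemma y_zpow_x (c : ℤ) :
    D.y * D.x ^ c * D.y⁻¹ = D.x ^ (c * (1 + D.p ^ (D.m - D.r) : ℕ)) := by
  rw [← conj_zpow, y_x, mul_comm, zpow_mul, zpow_natCast]

lemma y_pow_x (j : ℕ) :
    D.y ^ j * D.x * (D.y ^ j)⁻¹ = D.x ^ (((1 + D.p ^ (D.m - D.r) : ℕ) : ℤ) ^ j) := by
  induction j with
  | zero => simp
  | succ j ih =>
    have : D.y ^ (j + 1) * D.x * (D.y ^ (j + 1))⁻¹ =
        D.y * (D.y ^ j * D.x * (D.y ^ j)⁻¹) * D.y⁻¹ := by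
      rw [pow_succ']; group
    rw [this, ih, y_zpow_x, pow_succ]

lemma x_y_pow (c : ℤ) (l : ℕ) :
    (D.x ^ c * D.y) ^ l = D.x ^ (c * geomS (1 + D.p ^ (D.m - D.r) : ℕ) l) * D.y ^ l := by
  induction l with
  | zero => simp [geomS]
  | succ l ih =>
    have hs : geomS ((1 + D.p ^ (D.m - D.r) : ℕ) : ℤ) (l + 1) =
        1 + geomS ((1 + D.p ^ (D.m - D.r) : ℕ) : ℤ) l * (1 + D.p ^ (D.m - D.r) : ℕ) := by
      rw [geomS, Finset.sum_range_succ', geomS, Finset.sum_mul, add_comm]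
      simp [pow_succ]
    rw [pow_succ', ih, hs, mul_add, zpow_add, mul_one, ← mul_assoc c, ← y_zpow_x, pow_succ']
    group

lemma p_dvd_k_sub : (D.p : ℤ) ∣ ((1 + D.p ^ (D.m - D.r) : ℕ) : ℤ) - 1 := by
  have h1 := D.r_le
  have h2 := D.two_le_m
  push_cast
  rw [add_sub_cancel_left]
  exact dvd_pow_self _ (by omega)

lemma p_dvd_geomS {z : ℤ} (h : (D.p : ℤ) ∣ z - 1) : (D.p : ℤ) ∣ geomS z D.p := by
  have h1 : geomS z D.p ≡ geomS 1 D.p [ZMOD D.p] := by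
    apply Int.ModEq.sum
    intro i _
    exact ((Int.modEq_iff_dvd.mpr h).symm.pow i)
  have h2 : geomS 1 D.p = D.p := by simp [geomS]
  rw [h2] at h1
  exact h1.dvd_iff.mpr (dvd_refl _)

lemma sub_one_mul_geomS (z : ℤ) (l : ℕ) : (z - 1) * geomS z l = z ^ l - 1 := by
  rw [mul_comm]; exact geom_sum_mul z l

lemma dvd_pow_sub_one {z : ℤ} {s : ℕ} (hs : 1 ≤ s) (h : (D.p : ℤ) ^ s ∣ z - 1) (t : ℕ) :
    (D.p : ℤ) ^ (s + t) ∣ z ^ D.p ^ t - 1 := by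
  induction t with
  | zero => simpa using h
  | succ t ih =>
    rw [pow_succ, pow_mul, ← sub_one_mul_geomS, ← add_assoc, pow_succ]
    refine mul_dvd_mul ih (D.p_dvd_geomS (dvd_trans ?_ ih))
    exact dvd_pow_self _ (by omega)

lemma geomS_mul (z : ℤ) (a b : ℕ) : geomS z (a * b) = geomS z a * geomS (z ^ a) b := by
  induction b with
  | zero => simp [geomS]
  | succ b ih =>
    rw [mul_add, mul_one]
    have h1 : geomS z (a * b + a) = geomS z (a * b) + z ^ (a * b) * geomS z a := by
      rw [geomS, Finset.sum_range_add, geomS, geomS, Finset.mul_sum]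
      simp [pow_add]
    rw [h1, ih]
    have h2 : geomS (z ^ a) (b + 1) = geomS (z ^ a) b + z ^ (a * b) := by
      rw [geomS, Finset.sum_range_succ, ← pow_mul, geomS]
    rw [h2]; ring

lemma pow_dvd_geomS {z : ℤ} (h : (D.p : ℤ) ∣ z - 1) (t : ℕ) :
    (D.p : ℤ) ^ t ∣ geomS z (D.p ^ t) := by
  induction t with
  | zero => simp
  | succ t ih =>
    rw [pow_succ (D.p : ℕ), geomS_mul, pow_succ]
    refine mul_dvd_mul ih (D.p_dvd_geomS ?_)
    refine dvd_trans h ?_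
    simpa using sub_dvd_pow_sub_pow z 1 (D.p ^ t)

/-! ### The automorphisms `α`, `β`, `δ` -/

/-- The endomorphism `x ↦ x ^ e`, `y ↦ y`. -/
def alphaHom (e : ℤ) : D.G →* D.G :=
  D.homOf (D.x ^ e) D.y
    (by rw [← zpow_natCast, ← zpow_mul, mul_comm, zpow_mul, zpow_natCast, x_pow, one_zpow])
    D.y_pow
    (by rw [y_zpow_x, zpow_mul, zpow_natCast])

/-- The endomorphism `x ↦ x`, `y ↦ x ^ (c * p ^ max {m - n, 0}) * y`. -/
def betaHom (c : ℤ) : D.G →* D.G :=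
  D.homOf D.x (D.x ^ (c * D.p ^ (D.m - D.n)) * D.y) D.x_pow
    (by
      rw [x_y_pow, y_pow, mul_one]
      rw [← zpow_zero D.x]
      apply zpow_x_eq
      rw [sub_zero, mul_assoc]
      apply Dvd.dvd.mul_left
      refine dvd_trans (pow_dvd_pow _ (?_ : D.m ≤ (D.m - D.n) + D.n)) ?_
      · omega
      rw [pow_add]
      exact mul_dvd_mul (dvd_refl _) (D.pow_dvd_geomS D.p_dvd_k_sub _))
    (by
      rw [← y_x, mul_inv_rev]
      have : D.x ^ (c * (D.p : ℤ) ^ (D.m - D.n)) * D.y * D.x *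
          (D.y⁻¹ * (D.x ^ (c * (D.p : ℤ) ^ (D.m - D.n)))⁻¹) =
          D.x ^ (c * (D.p : ℤ) ^ (D.m - D.n)) * (D.y * D.x * D.y⁻¹) *
          (D.x ^ (c * (D.p : ℤ) ^ (D.m - D.n)))⁻¹ := by group
      rw [this, y_x]
      group)

/-- The endomorphism `x ↦ x`, `y ↦ y ^ f`, for `f ≡ 1` modulo `p ^ r`. -/
def deltaHom (f : ℕ) (hf : (D.p : ℤ) ^ D.r ∣ (f : ℤ) - 1) : D.G →* D.G :=
  D.homOf D.x (D.y ^ f) D.x_pow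
    (by rw [← pow_mul, mul_comm, pow_mul, y_pow, one_pow])
    (by
      have h1 := D.r_le
      have h2 := D.two_le_m
      have hr := D.one_le_r
      have hp := D.prime_p.two_le
      rw [y_pow_x, ← zpow_natCast]
      apply zpow_x_eq
      obtain ⟨t, ht⟩ := hf
      have ht0 : 0 ≤ t ∨ f = 0 := by
        by_contra! hcon
        have h3 : (D.p : ℤ) ^ D.r * t ≤ - (D.p : ℤ) ^ D.r := by
          have : (0 : ℤ) < (D.p : ℤ) ^ D.r := by positivity
          nlinarith [hcon.1]
        have h4 : (1 : ℤ) ≤ (D.p : ℤ) ^ D.r := by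
          have : (0 : ℤ) < (D.p : ℤ) ^ D.r := by positivity
          linarith
        have : 1 ≤ f := Nat.one_le_iff_ne_zero.mpr hcon.2
        omega
      have ht1 : f ≠ 0 := by
        rintro rfl
        have hd : (D.p : ℤ) ∣ 1 := by
          have h5 : (D.p : ℤ) ∣ (D.p : ℤ) ^ D.r * t := (dvd_pow_self _ (by omega)).mul_right t
          rw [← ht] at h5
          simpa using h5
        have := Int.le_of_dvd one_pos hd
        omega
      have ht2 : 0 ≤ t := ht0.resolve_right ht1
      lift t to ℕ using ht2
      have hf' : f = 1 + D.p ^ D.r * t := by zify; linarith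
      have hk := D.dvd_pow_sub_one (z := ((1 + D.p ^ (D.m - D.r) : ℕ) : ℤ)) (s := D.m - D.r)
        (by omega) (by push_cast; simp) D.r
      rw [Nat.sub_add_cancel (by omega)] at hk
      rw [hf', pow_add, pow_one, pow_mul]
      have h6 := hk.trans (sub_dvd_pow_sub_pow
        (((1 + D.p ^ (D.m - D.r) : ℕ) : ℤ) ^ D.p ^ D.r) 1 t)
      rw [one_pow] at h6
      have h7 := h6.mul_left (((1 + D.p ^ (D.m - D.r) : ℕ) : ℤ))
      rwa [mul_sub, mul_one] at h7)

lemma exists_u_inv : ∃ e : ℤ, (D.p : ℤ) ^ D.m ∣ D.u * e - 1 := by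
  obtain ⟨w, hw, -⟩ := D.u_gen
  have : NeZero (D.p ^ D.m) := ⟨pow_ne_zero _ D.prime_p.ne_zero⟩
  refine ⟨(((w⁻¹ : (ZMod (D.p ^ D.m))ˣ) : ZMod (D.p ^ D.m)).val : ℤ), ?_⟩
  have h : ((D.p ^ D.m : ℕ) : ℤ) ∣
      D.u * (((w⁻¹ : (ZMod (D.p ^ D.m))ˣ) : ZMod (D.p ^ D.m)).val : ℤ) - 1 := by
    rw [← ZMod.intCast_zmod_eq_zero_iff_dvd]
    push_cast
    rw [ZMod.natCast_zmod_val, ← hw, Units.mul_inv, sub_self]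
  simpa using h

lemma exists_delta_inv : ∃ f : ℕ, (1 + D.p ^ D.r) * f ≡ 1 [MOD D.p ^ D.n] ∧
    (D.p : ℤ) ^ D.r ∣ (f : ℤ) - 1 := by
  have h1 := D.r_le
  have hr := D.one_le_r
  have hn := D.one_le_n
  have hc : Nat.Coprime (1 + D.p ^ D.r) (D.p ^ D.n) := by
    apply Nat.Coprime.pow_right
    have : Nat.Coprime (1 + D.p * D.p ^ (D.r - 1)) D.p := by simp
    rwa [← pow_succ', Nat.sub_add_cancel hr] at this
  obtain ⟨f, -, hf⟩ := Nat.exists_mul_mod_eq_one_of_coprime hc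
    (Nat.one_lt_pow (by omega) D.prime_p.one_lt)
  have hf' : (1 + D.p ^ D.r) * f ≡ 1 [MOD D.p ^ D.n] := by
    rw [Nat.ModEq, hf, Nat.mod_eq_of_lt (Nat.one_lt_pow (by omega) D.prime_p.one_lt)]
  refine ⟨f, hf', ?_⟩
  have h2 := hf'.of_dvd (pow_dvd_pow D.p (by omega : D.r ≤ D.n))
  have h3 := (Nat.modEq_iff_dvd.mp h2.symm)
  push_cast at h3
  have h4 : (f : ℤ) - 1 = ((1 + (D.p : ℤ) ^ D.r) * f - 1) - (D.p : ℤ) ^ D.r * f := by ring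
  rw [h4]
  exact dvd_sub h3 (dvd_mul_right _ _)

/-- `α(x) = x ^ u` and `α(y) = y`. -/
noncomputable def alpha : MulAut D.G :=
  MonoidHom.toMulEquiv (D.alphaHom D.u) (D.alphaHom D.exists_u_inv.choose)
    (by
      apply D.hom_ext
      · simp only [MonoidHom.comp_apply, alphaHom, homOf_x, map_zpow, MonoidHom.id_apply,
          ← zpow_mul]
        nth_rw 2 [← zpow_one D.x]
        rw [mul_comm]
        exact D.zpow_x_eq D.exists_u_inv.choose_spec
      · simp [alphaHom, homOf_y])
    (by
      apply D.hom_ext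
      · simp only [MonoidHom.comp_apply, alphaHom, homOf_x, map_zpow, MonoidHom.id_apply,
          ← zpow_mul]
        nth_rw 2 [← zpow_one D.x]
        exact D.zpow_x_eq D.exists_u_inv.choose_spec
      · simp [alphaHom, homOf_y])

/-- `β(x) = x` and `β(y) = x ^ (p ^ max {m - n, 0}) * y`. -/
noncomputable def beta : MulAut D.G :=
  MonoidHom.toMulEquiv (D.betaHom 1) (D.betaHom (-1))
    (by
      apply D.hom_ext
      · simp [betaHom, homOf_x]
      · simp [betaHom, homOf_x, homOf_y])
    (by
      apply D.hom_ext
      · simp [betaHom, homOf_x]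
      · simp [betaHom, homOf_x, homOf_y])

/-- `δ(x) = x` and `δ(y) = y ^ (1 + p ^ r)`. -/
noncomputable def delta : MulAut D.G :=
  MonoidHom.toMulEquiv (D.deltaHom (1 + D.p ^ D.r) (by push_cast; simp))
    (D.deltaHom D.exists_delta_inv.choose D.exists_delta_inv.choose_spec.2)
    (by
      apply D.hom_ext
      · simp [deltaHom, homOf_x]
      · simp only [MonoidHom.comp_apply, deltaHom, homOf_y, map_pow, MonoidHom.id_apply,
          ← pow_mul]
        nth_rw 2 [← pow_one D.y]
        rw [mul_comm]
        exact D.pow_y_eq D.exists_delta_inv.choose_spec.1)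
    (by
      apply D.hom_ext
      · simp [deltaHom, homOf_x]
      · simp only [MonoidHom.comp_apply, deltaHom, homOf_y, map_pow, MonoidHom.id_apply,
          ← pow_mul]
        nth_rw 2 [← pow_one D.y]
        exact D.pow_y_eq D.exists_delta_inv.choose_spec.1)

theorem alpha_x : D.alpha D.x = D.x ^ D.u := (D.homOf_x _ _ _ _ _ : D.alphaHom D.u D.x = _)

theorem alpha_y : D.alpha D.y = D.y := (D.homOf_y _ _ _ _ _ : D.alphaHom D.u D.y = _)

theorem beta_x : D.beta D.x = D.x := (D.homOf_x _ _ _ _ _ : D.betaHom 1 D.x = _)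

theorem beta_y : D.beta D.y = D.x ^ D.p ^ (D.m - D.n) * D.y := by
  refine (D.homOf_y _ _ _ _ _ : D.betaHom 1 D.y = _).trans ?_
  rw [one_mul, ← zpow_natCast]
  push_cast
  rfl

theorem delta_x : D.delta D.x = D.x := (D.homOf_x _ _ _ _ _ : D.deltaHom (1 + D.p ^ D.r) (by push_cast; simp) D.x = _)

theorem delta_y : D.delta D.y = D.y ^ (1 + D.p ^ D.r) := (D.homOf_y _ _ _ _ _ : D.deltaHom (1 + D.p ^ D.r) (by push_cast; simp) D.y = _)

/-- `α̃ = α ^ ((p - 1) p ^ (m - r - 1))`. -/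
noncomputable def alphaT : MulAut D.G := D.alpha ^ ((D.p - 1) * D.p ^ (D.m - D.r - 1))

/-- `β̃ = β ^ (p ^ (min {m, n} - r))`. -/
noncomputable def betaT : MulAut D.G := D.beta ^ D.p ^ (min D.m D.n - D.r)

/-- `δ̃ = δ ^ (p ^ max {n - 2 r, 0})`. -/
noncomputable def deltaT : MulAut D.G := D.delta ^ D.p ^ (D.n - 2 * D.r)

/-- The integer `ũ = u ^ ((p - 1) p ^ (m - r - 1))`. -/
def uT : ℤ := D.u ^ ((D.p - 1) * D.p ^ (D.m - D.r - 1))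

/-- The integer `ṽ = (1 + p ^ r) ^ (p ^ max {n - 2 r, 0})`. -/
def vT : ℤ := (1 + (D.p : ℤ) ^ D.r) ^ D.p ^ (D.n - 2 * D.r)

/-! ### Admissible triplets -/

/-- `(a, b, d)` is admissible: the assignments `Γ(x) = β̃ ^ b`, `Γ(y) = α̃ ^ a δ̃ ^ d` extend to an
antihomomorphism `Γ : G → Aut(G)` which is `Aut(G)`-equivariant. -/
def Admissible (a b d : ℤ) : Prop :=
  ∃ Γ : D.G → MulAut D.G, Γ D.x = D.betaT ^ b ∧ Γ D.y = D.alphaT ^ a * D.deltaT ^ d ∧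
    (∀ σ τ : D.G, Γ (σ * τ) = Γ τ * Γ σ) ∧
    ∀ (φ : MulAut D.G) (σ : D.G), Γ (φ σ) = φ * Γ σ * φ⁻¹

/-- The class of `(a, b, d)` modulo `𝕄 = p ^ r ℤ × p ^ r ℤ × p ^ min {r, n - r} ℤ`. -/
def classModM (a b d : ℤ) :
    ZMod (D.p ^ D.r) × ZMod (D.p ^ D.r) × ZMod (D.p ^ min D.r (D.n - D.r)) :=
  (a, b, d)

/-- The isomorphism criterion: `ũ ^ a (1 + (1 - b) p ^ (m - r)) ≢ 1` modulo `p ^ (m - r + 1)`. -/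
def IsoCriterion (a b : ℤ) : Prop :=
  zpowMod (D.p ^ (D.m - D.r + 1)) D.uT a *
    ((1 + (1 - b) * (D.p : ℤ) ^ (D.m - D.r) : ℤ) : ZMod (D.p ^ (D.m - D.r + 1))) ≠ 1

/-- `j` is an admitted choice of the exponent `j_{a,b,d}` (for triplets that satisfy the isomorphism
criterion): it is coprime to `p` and
`(ũ ^ a (1 + (1 - b) p ^ (m - r))) ^ j ≡ 1 + p ^ (m - r)` modulo `p ^ m`. -/
def IsJ (a b : ℤ) (j : ℕ) : Prop :=
  Nat.Coprime j D.p ∧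
  (zpowMod (D.p ^ D.m) D.uT a *
    ((1 + (1 - b) * (D.p : ℤ) ^ (D.m - D.r) : ℤ) : ZMod (D.p ^ D.m))) ^ j =
      ((1 + (D.p : ℤ) ^ (D.m - D.r) : ℤ) : ZMod (D.p ^ D.m))

/-! ### The bijections -/

/-- The right regular representation `ρ(σ) = (τ ↦ τ σ⁻¹)`. -/
def rho (σ : D.G) : Equiv.Perm D.G := Equiv.mulRight σ⁻¹

/-- `Φ_x = ρ(x) β̃ ^ b`. -/
noncomputable def PhiX (b : ℤ) : Equiv.Perm D.G :=
  D.rho D.x * MulAut.toPerm D.G (D.betaT ^ b)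

/-- `Φ_y = ρ(y) α̃ ^ a δ̃ ^ d`. -/
noncomputable def PhiY (a d : ℤ) : Equiv.Perm D.G :=
  D.rho D.y * MulAut.toPerm D.G (D.alphaT ^ a * D.deltaT ^ d)

/-- `f` is the bijection `π_{a,b,d} : x ^ i y ^ j ↦ (Φ_x ^ i Φ_y ^ (j₀ j))(1)`, formed with the
choice `j₀` of `j_{a,b,d}`. As every element of `G` is some `x ^ i y ^ j`, there is at most one. -/
def IsPi (a b d : ℤ) (j₀ : ℕ) (f : Equiv.Perm D.G) : Prop :=
  ∀ i j : ℤ, f (D.x ^ i * D.y ^ j) = (D.PhiX b ^ i * D.PhiY a d ^ ((j₀ : ℤ) * j)) 1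

/-- `f` is the bijection `π'_v : x ^ i y ^ j ↦ x ^ i y ^ S(v, j)`, for `j ≥ 0`. As every element of
`G` is some `x ^ i y ^ j` with `j ≥ 0`, there is at most one. -/
def IsPi' (v : ℤ) (f : Equiv.Perm D.G) : Prop :=
  ∀ (i : ℤ) (j : ℕ), f (D.x ^ i * D.y ^ j) = D.x ^ i * D.y ^ geomS v j

/-- `f ≡ g` modulo `Aut(G)`, i.e. `f` and `g` lie in the same coset of `Aut(G)` in `Perm(G)`:
`f = g ∘ φ` for some automorphism `φ`. -/
def EqModAut (f g : Equiv.Perm D.G) : Prop :=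
  ∃ φ : MulAut D.G, f = g * MulAut.toPerm D.G φ

end MetacyclicData

/-! For `m ≤ n` one has `β(y) = x y`, and `b = 0` makes `Γ(x)` trivial, so `Γ(xy) = Γ(y)` and
equivariance forces `Γ(y)` to commute with `β`. Comparing values at `y`, where `(xy)^v = x y^v`
because `v ≡ 1` mod `p^m`, gives `ũ^a ≡ 1` mod `p^m`; hence `p^r ∣ a` and `α̃^a = 1`
(`zpowMod_uT_of_admissible`, `pow_r_dvd_of_zpowMod_uT`). Conversely, every `(0, 0, d)` with `ṽ^d ≡
1` mod `p^m` is admissible, since `δ̃^d` is then central in `Aut(G)`; this rests on `mulAut_shape`.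
The count becomes one of residues `d` (`zpowMod_vT_eq_one_iff`).

Once `α̃^a = 1`, `Φ_y` is `τ ↦ δ̃^d(τ) y⁻¹`, so `Φ_y^l(1) = y^(-S(v,l))` and `π(x^i y^j) = (x^i
y^S(v, j₀ j))⁻¹`. As `j₀ ≡ 1` mod `p^r`, the assignment `x ↦ x`, `y ↦ y^j₀` is an automorphism `φ`,
and `ι ∘ π = π'_v ∘ φ`. -/

/-! ### Geometric sums and powers modulo `N` -/

lemma geomS_succ (v : ℤ) (l : ℕ) : geomS v (l + 1) = geomS v l + v ^ l := by
  simp [geomS, Finset.sum_range_succ]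

lemma geomS_succ' (v : ℤ) (l : ℕ) : geomS v (l + 1) = 1 + v * geomS v l := by
  simp [geomS, Finset.sum_range_succ', Finset.mul_sum, pow_succ', add_comm]

lemma geomS_add (v : ℤ) (a b : ℕ) : geomS v (a + b) = geomS v a + v ^ a * geomS v b := by
  simp [geomS, Finset.sum_range_add, Finset.mul_sum, pow_add]

/-- Powers with integer exponents modulo `N` are powers in the group of units. -/
lemma zpowMod_of_unit {N : ℕ} {z : ℤ} (w : (ZMod N)ˣ) (hw : (w : ZMod N) = z) (d : ℤ) :
    zpowMod N z d = ((w ^ d : (ZMod N)ˣ) : ZMod N) := by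
  cases d with
  | ofNat k => simp [zpowMod, hw]
  | negSucc k =>
    simp only [zpowMod, zpow_negSucc, ← hw, ZMod.inv_coe_unit]
    rw [← Units.val_pow_eq_pow_val, inv_pow]

lemma exists_unit_of_isCoprime {N : ℕ} {z : ℤ} (h : IsCoprime z N) :
    ∃ w : (ZMod N)ˣ, (w : ZMod N) = z := by
  obtain ⟨a, b, hab⟩ := h
  have h1 : (z : ZMod N) * a = 1 := by
    have := congrArg (Int.cast : ℤ → ZMod N) hab
    push_cast at this
    simpa [mul_comm] using this
  exact ⟨Units.mkOfMulEqOne _ _ h1, rfl⟩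

/-- Triviality of a power of a unit depends only on whether its order divides the exponent, so the
sign of `d` can be dropped. -/
lemma zpowMod_eq_one_iff {N : ℕ} {z : ℤ} (h : IsCoprime z N) (d : ℤ) :
    zpowMod N z d = 1 ↔ (N : ℤ) ∣ z ^ d.natAbs - 1 := by
  obtain ⟨w, hw⟩ := exists_unit_of_isCoprime h
  rw [zpowMod_of_unit w hw, Units.val_eq_one, ← orderOf_dvd_iff_zpow_eq_one, Int.natCast_dvd,
    orderOf_dvd_iff_pow_eq_one, ← Units.val_eq_one, Units.val_pow_eq_pow_val, hw,
    ← ZMod.intCast_zmod_eq_zero_iff_dvd]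
  push_cast
  rw [sub_eq_zero]

/-- If `ψ` raises `g` to the power `z`, then `ψ ^ d` raises `g` to the power `z ^ d`. -/
lemma mulAut_zpow_apply {H : Type*} [Group H] {N : ℕ} {g : H} (hg : g ^ N = 1) {z : ℤ}
    (hz : IsCoprime z N) (ψ : MulAut H) (hψ : ψ g = g ^ z) {d v : ℤ}
    (hv : (v : ZMod N) = zpowMod N z d) : (ψ ^ d) g = g ^ v := by
  have key : ∀ {a b : ℤ}, (a : ZMod N) = b → g ^ a = g ^ b := by
    intro a b hab
    rw [ZMod.intCast_eq_intCast_iff] at hab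
    exact zpow_eq_zpow_iff_modEq.mpr
      (hab.of_dvd (Int.natCast_dvd_natCast.mpr (orderOf_dvd_of_pow_eq_one hg)))
  have hn : ∀ k : ℕ, (ψ ^ k) g = g ^ (z ^ k) := by
    intro k
    induction k with
    | zero => simp
    | succ k ih => rw [pow_succ, MulAut.mul_apply, hψ, map_zpow, ih, ← zpow_mul, pow_succ]
  cases d with
  | ofNat k =>
    rw [Int.ofNat_eq_natCast, zpow_natCast, hn]
    apply key
    rw [hv]
    simp [zpowMod]
  | negSucc k =>
    rw [zpow_negSucc]
    apply (ψ ^ (k + 1)).injective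
    rw [MulAut.apply_inv_self, map_zpow, hn, ← zpow_mul]
    obtain ⟨w, hw⟩ := exists_unit_of_isCoprime hz
    rw [zpowMod_of_unit w hw] at hv
    have : g ^ (1 : ℤ) = g ^ (z ^ (k + 1) * v) := by
      apply key
      push_cast
      rw [hv, ← hw, zpow_negSucc, ← Units.val_pow_eq_pow_val, Units.mul_inv]
    rw [← this, zpow_one]

/-- Lifting the exponent for geometric sums. -/
lemma pow_dvd_geomS_iff {p : ℕ} (hp : p.Prime) (ho : Odd p) {v : ℤ} (hv : (p : ℤ) ∣ v - 1)
    (s l : ℕ) : (p : ℤ) ^ s ∣ geomS v l ↔ p ^ s ∣ l := by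
  have hpZ : Prime (p : ℤ) := Nat.prime_iff_prime_int.mp hp
  -- For `v = 1` the factor `v - 1` has infinite multiplicity and could not be cancelled below.
  rcases eq_or_ne v 1 with rfl | hv1
  · simp only [geomS, one_pow, Finset.sum_const, Finset.card_range, nsmul_eq_mul, mul_one]
    exact_mod_cast Int.natCast_dvd_natCast (m := p ^ s) (n := l)
  have hpv : ¬ (p : ℤ) ∣ v := fun h => hpZ.not_dvd_one (by simpa using dvd_sub h hv)
  have h1 := Int.emultiplicity_pow_sub_pow hp ho hv hpv l
  have h2 : (v - 1) * geomS v l = v ^ l - 1 := by rw [mul_comm]; exact geom_sum_mul v l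
  rw [one_pow, ← h2, emultiplicity_mul hpZ] at h1
  have hfin : FiniteMultiplicity (p : ℤ) (v - 1) :=
    Int.finiteMultiplicity_iff.mpr ⟨by simpa using hp.ne_one, sub_ne_zero.mpr hv1⟩
  have h3 : emultiplicity (p : ℤ) (geomS v l) = emultiplicity p l :=
    ENat.add_right_injective_of_ne_top (finiteMultiplicity_iff_emultiplicity_ne_top.mp hfin) h1
  rw [pow_dvd_iff_le_emultiplicity, h3, pow_dvd_iff_le_emultiplicity]

/-- Lifting the exponent for powers of `1 + p ^ s`. -/
lemma pow_dvd_one_add_pow_sub_one_iff {p : ℕ} (hp : p.Prime) (ho : Odd p) {s : ℕ} (hs : 1 ≤ s)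
    (e l : ℕ) : (p : ℤ) ^ (s + e) ∣ (1 + (p : ℤ) ^ s) ^ l - 1 ↔ p ^ e ∣ l := by
  have h0 : (p : ℤ) ^ s ≠ 0 := pow_ne_zero _ (by exact_mod_cast hp.ne_zero)
  have h2 : (p : ℤ) ^ s * geomS (1 + (p : ℤ) ^ s) l = (1 + (p : ℤ) ^ s) ^ l - 1 := by
    rw [mul_comm, ← geom_sum_mul, geomS]; simp
  rw [← h2, pow_add, mul_dvd_mul_iff_left h0]
  exact pow_dvd_geomS_iff hp ho (by simpa using dvd_pow_self (p : ℤ) (by omega)) e l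

/-! ### The normal form `x ^ i y ^ j` -/

namespace MetacyclicData

variable (D : MetacyclicData)

/-- The exponent `1 + p ^ (m - r)` by which `y` acts on `x`. -/
def k : ℕ := 1 + D.p ^ (D.m - D.r)

lemma r_lt_m : D.r < D.m := by have := D.r_le; have := D.two_le_m; omega

lemma r_le_n : D.r ≤ D.n := by have := D.r_le; omega

/-- So `k` has order exactly `p ^ r` modulo `p ^ m`; this is the source of the congruences modulo `p
^ r` on exponents of `y`. -/
lemma pow_dvd_k_pow_sub_one_iff (l : ℕ) :
    (D.p : ℤ) ^ D.m ∣ (D.k : ℤ) ^ l - 1 ↔ D.p ^ D.r ∣ l := by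
  have h := pow_dvd_one_add_pow_sub_one_iff D.prime_p D.odd_p (s := D.m - D.r)
    (by have := D.r_lt_m; omega) D.r l
  rw [Nat.sub_add_cancel D.r_lt_m.le] at h
  rw [← h, k]; push_cast; rfl

lemma p_dvd_k_pow_sub_one (t : ℕ) : (D.p : ℤ) ∣ (D.k : ℤ) ^ t - 1 := by
  have h := sub_dvd_pow_sub_pow (D.k : ℤ) 1 t
  rw [one_pow] at h
  exact D.p_dvd_k_sub.trans h

lemma y_pow_mul_x_zpow (j : ℕ) (c : ℤ) :
    D.y ^ j * D.x ^ c = D.x ^ (c * (D.k : ℤ) ^ j) * D.y ^ j := by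
  have h := D.y_pow_x j
  have h2 : (D.y ^ j * D.x * (D.y ^ j)⁻¹) ^ c = D.x ^ (c * (D.k : ℤ) ^ j) := by
    rw [h, ← zpow_mul, mul_comm]; rfl
  rw [conj_zpow] at h2
  rw [← h2]; group

lemma zpow_y_eq {a b : ℤ} (h : (D.p : ℤ) ^ D.n ∣ a - b) : D.y ^ a = D.y ^ b := by
  obtain ⟨c, hc⟩ := h
  have : a = b + (D.p ^ D.n : ℕ) * c := by push_cast; linarith
  rw [this, zpow_add, zpow_mul, zpow_natCast, y_pow, one_zpow, mul_one]

/-- The retraction of `G` onto `⟨y⟩`, with values in `ℤ / p ^ n`. -/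
def toY : D.G →* Multiplicative (ZMod (D.p ^ D.n)) :=
  PresentedGroup.toGroup (f := ![1, Multiplicative.ofAdd 1]) (by
    intro s hs
    simp only [rels, Set.mem_insert_iff, Set.mem_singleton_iff] at hs
    rcases hs with rfl | rfl | rfl
    · simp
    · simp only [map_pow, FreeGroup.lift_apply_of]
      apply Multiplicative.toAdd.injective
      simp only [Matrix.cons_val_one, Matrix.cons_val_fin_one, toAdd_pow, toAdd_ofAdd, toAdd_one,
        nsmul_eq_mul, mul_one]
      exact ZMod.natCast_self _
    · simp)

lemma toY_x : D.toY D.x = 1 := by simp [toY, x]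

lemma toY_y : D.toY D.y = Multiplicative.ofAdd 1 := by simp [toY, y]

lemma toY_eq (i j : ℤ) :
    D.toY (D.x ^ i * D.y ^ j) = Multiplicative.ofAdd (j : ZMod (D.p ^ D.n)) := by
  rw [map_mul, map_zpow, map_zpow, toY_x, toY_y, one_zpow, one_mul, ← ofAdd_zsmul, zsmul_one]

lemma exists_k_unit : ∃ w : (ZMod (D.p ^ D.m))ˣ, (w : ZMod (D.p ^ D.m)) = D.k ∧
    w ^ D.p ^ D.n = 1 := by
  have h1 : (D.k : ZMod (D.p ^ D.m)) ^ D.p ^ D.n = 1 := by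
    have h := (D.pow_dvd_k_pow_sub_one_iff (D.p ^ D.n)).mpr (pow_dvd_pow _ D.r_le_n)
    have h2 := (ZMod.intCast_zmod_eq_zero_iff_dvd ((D.k : ℤ) ^ (D.p ^ D.n) - 1) (D.p ^ D.m)).mpr
      (by exact_mod_cast h)
    push_cast at h2
    exact sub_eq_zero.mp h2
  refine ⟨Units.ofPowEqOne _ _ h1 (pow_ne_zero _ D.prime_p.ne_zero), rfl, ?_⟩
  exact Units.pow_ofPowEqOne _ _

/-- The action of `G` on `ℤ / p ^ m`, where `x` is a translation. -/
noncomputable def toPermX : D.G →* Equiv.Perm (ZMod (D.p ^ D.m)) :=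
  PresentedGroup.toGroup
    (f := ![Equiv.addRight 1, MulAction.toPerm D.exists_k_unit.choose]) (by
    have hadd : ∀ l : ℕ, (Equiv.addRight (1 : ZMod (D.p ^ D.m))) ^ l =
        Equiv.addRight (l : ZMod _) := by
      intro l
      simp
    intro s hs
    simp only [rels, Set.mem_insert_iff, Set.mem_singleton_iff] at hs
    rcases hs with rfl | rfl | rfl
    · simp only [map_pow, FreeGroup.lift_apply_of, Matrix.cons_val_zero]
      rw [hadd, ZMod.natCast_self]
      ext t; simp
    · simp only [map_pow, FreeGroup.lift_apply_of, Matrix.cons_val_one, Matrix.cons_val_fin_one]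
      have h := congrArg (MulAction.toPermHom _ (ZMod (D.p ^ D.m))) D.exists_k_unit.choose_spec.2
      rwa [map_pow, map_one] at h
    · simp only [map_pow, map_mul, map_inv, FreeGroup.lift_apply_of, Matrix.cons_val_one,
        Matrix.cons_val_fin_one, Matrix.cons_val_zero]
      rw [mul_inv_eq_one, mul_inv_eq_iff_eq_mul, hadd]
      ext t
      simp only [Equiv.Perm.mul_apply, Equiv.coe_addRight, MulAction.toPerm_apply, smul_add]
      congr 1
      rw [Units.smul_def, D.exists_k_unit.choose_spec.1, smul_eq_mul, mul_one]
      rfl)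

lemma toPermX_x : D.toPermX D.x = Equiv.addRight 1 := by simp [toPermX, x]

/-- Under `toPermX`, `x ^ i` moves `0` to `i`, so the presentation does not collapse `⟨x⟩`. -/
lemma x_zpow_eq_one_iff (i : ℤ) : D.x ^ i = 1 ↔ (D.p : ℤ) ^ D.m ∣ i := by
  constructor
  · intro h
    have h1 := congrArg D.toPermX h
    rw [map_zpow, toPermX_x, map_one] at h1
    have h2 := Equiv.congr_fun h1 0
    simp [ZMod.intCast_zmod_eq_zero_iff_dvd, -Nat.cast_pow] at h2
    exact_mod_cast h2
  · intro h
    rw [← zpow_zero D.x]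
    exact D.zpow_x_eq (by simpa using h)

lemma toY_eq_toY_iff (i j i' j' : ℤ) :
    D.toY (D.x ^ i * D.y ^ j) = D.toY (D.x ^ i' * D.y ^ j') ↔ (D.p : ℤ) ^ D.n ∣ j - j' := by
  rw [toY_eq, toY_eq, Multiplicative.ofAdd.apply_eq_iff_eq, eq_comm,
    ZMod.intCast_eq_intCast_iff_dvd_sub]
  push_cast; rfl

/-- Uniqueness of the normal form `x ^ i y ^ j`. -/
lemma normal_form_eq_iff (i j i' j' : ℤ) : D.x ^ i * D.y ^ j = D.x ^ i' * D.y ^ j' ↔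
    (D.p : ℤ) ^ D.m ∣ i - i' ∧ (D.p : ℤ) ^ D.n ∣ j - j' := by
  constructor
  · intro h
    have h1 := (D.toY_eq_toY_iff i j i' j').mp (congrArg D.toY h)
    refine ⟨?_, h1⟩
    rw [D.zpow_y_eq h1] at h
    rw [← x_zpow_eq_one_iff, zpow_sub, mul_right_cancel h, mul_inv_cancel]
  · rintro ⟨h1, h2⟩
    rw [D.zpow_x_eq h1, D.zpow_y_eq h2]

/-- Existence of the normal form `x ^ i y ^ j`. -/
lemma exists_normal_form (g : D.G) : ∃ (i : ℤ) (j : ℕ), g = D.x ^ i * D.y ^ j := by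
  induction g using PresentedGroup.induction_on with
  | _ z =>
    induction z using FreeGroup.induction_on with
    | C1 => exact ⟨0, 0, by simp⟩
    | of t =>
      fin_cases t
      · exact ⟨1, 0, by simp; rfl⟩
      · exact ⟨0, 1, by simp; rfl⟩
    | inv_of t _ =>
      fin_cases t
      · exact ⟨-1, 0, by simp; rfl⟩
      -- The exponent of `y` is a natural number, so `y⁻¹` is written `y ^ (p ^ n - 1)`.
      · refine ⟨0, D.p ^ D.n - 1, ?_⟩
        have h1 : D.y ^ (D.p ^ D.n - 1) * D.y = 1 := by
          rw [← pow_succ, Nat.sub_add_cancel (Nat.one_le_pow _ _ D.prime_p.pos), y_pow]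
        rw [zpow_zero, one_mul, map_inv]
        exact (eq_inv_of_mul_eq_one_left h1).symm
    | mul a b ha hb =>
      obtain ⟨i, j, hij⟩ := ha
      obtain ⟨i', j', hij'⟩ := hb
      refine ⟨i + i' * (D.k : ℤ) ^ j, j + j', ?_⟩
      rw [map_mul, hij, hij', zpow_add, pow_add, mul_assoc, ← mul_assoc (D.y ^ j),
        y_pow_mul_x_zpow]
      group

instance : Finite D.G := by
  have : NeZero (D.p ^ D.m) := ⟨pow_ne_zero _ D.prime_p.ne_zero⟩
  have : NeZero (D.p ^ D.n) := ⟨pow_ne_zero _ D.prime_p.ne_zero⟩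
  choose i j hij using D.exists_normal_form
  refine Finite.of_injective
    (fun g => ((i g : ZMod (D.p ^ D.m)), ((j g : ℤ) : ZMod (D.p ^ D.n)))) ?_
  intro g g' h
  simp only [Prod.mk.injEq, ZMod.intCast_eq_intCast_iff_dvd_sub] at h
  rw [hij g, hij g', ← zpow_natCast, ← zpow_natCast D.y]
  exact ((D.normal_form_eq_iff _ _ _ _).mpr
    ⟨by exact_mod_cast h.1, by exact_mod_cast h.2⟩).symm

end MetacyclicData

lemma zpowMod_natCast (N : ℕ) (z : ℤ) (l : ℕ) : zpowMod N z l = (z : ZMod N) ^ l := rfl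

lemma mulAut_zpow_fix {H : Type*} [Group H] {ψ : MulAut H} {g : H} (h : ψ g = g) (d : ℤ) :
    (ψ ^ d) g = g :=
  Subgroup.zpow_mem (MulAction.stabilizer (MulAut H) g) h d

lemma intCast_eq_zpowMod_of_dvd {N N' : ℕ} (hN : N ∣ N') {z v d : ℤ} (hz : IsCoprime z N')
    (hv : (v : ZMod N') = zpowMod N' z d) : (v : ZMod N) = zpowMod N z d := by
  obtain ⟨w, hw⟩ := exists_unit_of_isCoprime hz
  rw [zpowMod_of_unit w hw] at hv
  rw [zpowMod_of_unit (Units.map (ZMod.castHom hN (ZMod N)).toMonoidHom w) (by simp [hw]),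
    ← map_zpow]
  have := congrArg (ZMod.castHom hN (ZMod N)) hv
  rw [map_intCast] at this
  exact this

/-! ### Values of `α̃ ^ a` and `δ̃ ^ d` on the generators -/

namespace MetacyclicData

variable (D : MetacyclicData)

lemma isCoprime_u : IsCoprime D.u ((D.p ^ D.m : ℕ) : ℤ) := by
  obtain ⟨e, c, hc⟩ := D.exists_u_inv
  exact ⟨e, -c, by push_cast; linear_combination hc⟩

lemma isCoprime_uT : IsCoprime D.uT ((D.p ^ D.m : ℕ) : ℤ) := D.isCoprime_u.pow_left

lemma isCoprime_vT (s : ℕ) : IsCoprime D.vT ((D.p ^ s : ℕ) : ℤ) := by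
  push_cast
  refine IsCoprime.pow ?_
  obtain ⟨e, he⟩ : ∃ e, D.r = e + 1 := ⟨D.r - 1, by have := D.one_le_r; omega⟩
  exact ⟨1, -(D.p : ℤ) ^ e, by rw [he]; ring⟩

lemma alphaT_x : D.alphaT D.x = D.x ^ D.uT := by
  have h := mulAut_zpow_apply D.x_pow D.isCoprime_u D.alpha D.alpha_x
    (d := ((D.p - 1) * D.p ^ (D.m - D.r - 1) : ℕ)) (v := D.uT)
    (by rw [uT, zpowMod_natCast]; push_cast; rfl)
  rwa [zpow_natCast] at h

lemma alphaT_y : D.alphaT D.y = D.y := by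
  have h := mulAut_zpow_fix D.alpha_y ((D.p - 1) * D.p ^ (D.m - D.r - 1) : ℕ)
  rwa [zpow_natCast] at h

lemma deltaT_x : D.deltaT D.x = D.x := by
  have h := mulAut_zpow_fix D.delta_x (D.p ^ (D.n - 2 * D.r) : ℕ)
  rwa [zpow_natCast] at h

lemma isCoprime_one_add (s : ℕ) : IsCoprime (1 + (D.p : ℤ) ^ D.r) ((D.p ^ s : ℕ) : ℤ) := by
  push_cast
  refine IsCoprime.pow_right ?_
  obtain ⟨e, he⟩ : ∃ e, D.r = e + 1 := ⟨D.r - 1, by have := D.one_le_r; omega⟩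
  exact ⟨1, -(D.p : ℤ) ^ e, by rw [he]; ring⟩

lemma deltaT_y : D.deltaT D.y = D.y ^ D.vT := by
  have h := mulAut_zpow_apply D.y_pow (D.isCoprime_one_add D.n) D.delta
    (by rw [delta_y, ← zpow_natCast]; push_cast; rfl)
    (d := (D.p ^ (D.n - 2 * D.r) : ℕ)) (v := D.vT) (by rw [vT, zpowMod_natCast]; push_cast; rfl)
  rwa [zpow_natCast] at h

lemma alphaT_zpow_x {a U : ℤ} (hU : (U : ZMod (D.p ^ D.m)) = zpowMod (D.p ^ D.m) D.uT a) :
    (D.alphaT ^ a) D.x = D.x ^ U :=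
  mulAut_zpow_apply D.x_pow D.isCoprime_uT _ D.alphaT_x hU

lemma alphaT_zpow_y (a : ℤ) : (D.alphaT ^ a) D.y = D.y := mulAut_zpow_fix D.alphaT_y a

lemma deltaT_zpow_y {d v : ℤ} (hv : (v : ZMod (D.p ^ D.n)) = zpowMod (D.p ^ D.n) D.vT d) :
    (D.deltaT ^ d) D.y = D.y ^ v :=
  mulAut_zpow_apply D.y_pow (D.isCoprime_vT _) _ D.deltaT_y hv

lemma deltaT_zpow_x (d : ℤ) : (D.deltaT ^ d) D.x = D.x := mulAut_zpow_fix D.deltaT_x d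

lemma mulAut_ext {f g : MulAut D.G} (hx : f D.x = g D.x) (hy : f D.y = g D.y) : f = g :=
  MulEquiv.toMonoidHom_injective (D.hom_ext hx hy)

lemma x_y_pow_pow (c : ℤ) (t l : ℕ) : (D.x ^ c * D.y ^ t) ^ l =
    D.x ^ (c * geomS ((D.k : ℤ) ^ t) l) * D.y ^ (t * l) := by
  induction l with
  | zero => simp [geomS]
  | succ l ih =>
    rw [pow_succ, ih, mul_assoc, ← mul_assoc (D.y ^ (t * l)), y_pow_mul_x_zpow, geomS_succ,
      mul_add, zpow_add, pow_mul (D.k : ℤ), mul_add, mul_one, pow_add]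
    group

/-- Raising to a power `v ≡ 1` modulo `p ^ m` fixes the `x`-part of the normal form. -/
lemma x_y_zpow_of_dvd (s : ℤ) (t : ℕ) {v : ℤ} (hv : (D.p : ℤ) ^ D.m ∣ v - 1) :
    (D.x ^ s * D.y ^ t) ^ v = D.x ^ s * D.y ^ (t * v) := by
  obtain ⟨w, hw⟩ := hv
  -- The `x`-exponent is a multiple of a geometric sum of length `p ^ m` with ratio `k ^ t ≡ 1` mod
  -- `p`, hence vanishes modulo `p ^ m`.
  have h1 : (D.x ^ s * D.y ^ t) ^ (D.p ^ D.m) = D.y ^ (t * D.p ^ D.m) := by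
    rw [x_y_pow_pow, (D.x_zpow_eq_one_iff _).mpr, one_mul]
    exact (D.pow_dvd_geomS (D.p_dvd_k_pow_sub_one t) _).mul_left _
  obtain rfl : v = 1 + (D.p ^ D.m : ℕ) * w := by push_cast; linarith
  rw [zpow_add, zpow_mul, zpow_natCast, h1, zpow_one, ← zpow_natCast D.y, ← zpow_natCast D.y,
    ← zpow_mul, mul_assoc, ← zpow_add]
  congr 2
  push_cast; ring

/-! ### Admissibility makes `α̃ ^ a` trivial -/

lemma pow_dvd_sub_one_of_zpowMod (hmn : D.m ≤ D.n) {d v : ℤ}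
    (hv : (v : ZMod (D.p ^ D.n)) = zpowMod (D.p ^ D.n) D.vT d)
    (hd : zpowMod (D.p ^ D.m) D.vT d = 1) : (D.p : ℤ) ^ D.m ∣ v - 1 := by
  have h := intCast_eq_zpowMod_of_dvd (pow_dvd_pow D.p hmn) (D.isCoprime_vT _) hv
  rw [hd, ← Int.cast_one, eq_comm, ZMod.intCast_eq_intCast_iff_dvd_sub] at h
  exact_mod_cast h

/-- Equivariance is tested on `beta` alone: `Γ(y) β = β Γ(y)` evaluated at `y` reads `x^U y^v =
(xy)^v = x y^v`. -/
lemma zpowMod_uT_of_admissible (hmn : D.m ≤ D.n) {a d : ℤ} (h : D.Admissible a 0 d)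
    (hd : zpowMod (D.p ^ D.m) D.vT d = 1) : zpowMod (D.p ^ D.m) D.uT a = 1 := by
  obtain ⟨Γ, hΓx, hΓy, hanti, hequiv⟩ := h
  obtain ⟨v, hv⟩ := ZMod.intCast_surjective (zpowMod (D.p ^ D.n) D.vT d)
  obtain ⟨U, hU⟩ := ZMod.intCast_surjective (zpowMod (D.p ^ D.m) D.uT a)
  have hv1 := D.pow_dvd_sub_one_of_zpowMod hmn hv hd
  have hbeta : D.beta D.y = D.x * D.y := by
    rw [beta_y, Nat.sub_eq_zero_of_le hmn, pow_zero, pow_one]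
  have h1 := hequiv D.beta D.y
  rw [hbeta, hanti, hΓx, zpow_zero, mul_one, eq_mul_inv_iff_mul_eq] at h1
  have h2 := DFunLike.congr_fun h1 D.y
  have hy : Γ D.y D.y = D.y ^ v := by
    rw [hΓy, MulAut.mul_apply, D.deltaT_zpow_y hv, map_zpow, alphaT_zpow_y]
  have hx : Γ D.y D.x = D.x ^ U := by
    rw [hΓy, MulAut.mul_apply, deltaT_zpow_x, D.alphaT_zpow_x hU]
  have h3 := D.x_y_zpow_of_dvd 1 1 hv1
  rw [zpow_one, pow_one, Nat.cast_one, one_mul] at h3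
  rw [MulAut.mul_apply, MulAut.mul_apply, hbeta, map_mul, hx, hy, map_zpow, hbeta, h3] at h2
  have h4 := ((D.normal_form_eq_iff U v 1 v).mp (by rwa [zpow_one])).1
  rw [← hU, ← Int.cast_one, eq_comm, ZMod.intCast_eq_intCast_iff_dvd_sub]
  exact_mod_cast h4

/-- A generator `u` has order `(p - 1) p ^ (m - 1)`, so its power `ũ` has order `p ^ r`. -/
lemma pow_r_dvd_of_zpowMod_uT {a : ℤ} (h : zpowMod (D.p ^ D.m) D.uT a = 1) :
    (D.p : ℤ) ^ D.r ∣ a := by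
  have : NeZero (D.p ^ D.m) := ⟨pow_ne_zero _ D.prime_p.ne_zero⟩
  rw [zpowMod_eq_one_iff D.isCoprime_uT, uT, ← pow_mul] at h
  obtain ⟨w, hw, hgen⟩ := D.u_gen
  have h1 : w ^ ((D.p - 1) * D.p ^ (D.m - D.r - 1) * a.natAbs) = 1 := by
    rw [← Units.val_eq_one, Units.val_pow_eq_pow_val, hw]
    rw [← ZMod.intCast_zmod_eq_zero_iff_dvd, Int.cast_sub, sub_eq_zero] at h
    exact_mod_cast h
  have h2 := orderOf_eq_card_of_forall_mem_zpowers hgen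
  have h0 := D.r_lt_m
  have hp := D.prime_p.two_le
  rw [Nat.card_eq_fintype_card, ZMod.card_units_eq_totient,
    Nat.totient_prime_pow D.prime_p (by omega)] at h2
  have h3 := orderOf_dvd_of_pow_eq_one h1
  rw [h2, mul_comm, mul_assoc, show D.m - 1 = (D.m - D.r - 1) + D.r by omega, pow_add] at h3
  have h4 := Nat.dvd_of_mul_dvd_mul_left (by omega) h3
  have h5 := Nat.dvd_of_mul_dvd_mul_left (pow_pos D.prime_p.pos _) h4
  have h6 := Int.natCast_dvd.mpr h5
  exact_mod_cast h6

lemma alphaT_zpow_eq_one {a : ℤ} (h : zpowMod (D.p ^ D.m) D.uT a = 1) : D.alphaT ^ a = 1 := by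
  apply D.mulAut_ext
  · rw [D.alphaT_zpow_x (U := 1) (by rw [h, Int.cast_one]), zpow_one]; rfl
  · exact D.alphaT_zpow_y a

/-! ### Automorphisms of `G` -/

/-- Cancel one factor of the unit `k` and use its order. This serves both for the `y`-exponent of
`φ(y)` and for `j₀`. -/
lemma pow_r_dvd_sub_one {t : ℕ} (ht : (D.p : ℤ) ^ D.m ∣ (D.k : ℤ) ^ t - D.k) :
    (D.p : ℤ) ^ D.r ∣ t - 1 := by
  have hr := D.r_lt_m
  have hr1 := D.one_le_r
  have hp := D.prime_p
  cases t with
  | zero =>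
    have h1 := (D.pow_dvd_k_pow_sub_one_iff 1).mp (by
      rw [pow_one, ← dvd_neg, neg_sub]; simpa using ht)
    have h2 := (dvd_pow_self D.p (by omega)).trans h1
    exact absurd (Nat.dvd_one.mp h2) hp.ne_one
  | succ t =>
    have hk : IsCoprime ((D.p : ℤ) ^ D.m) D.k := by
      refine IsCoprime.pow_left ?_
      obtain ⟨e, he⟩ : ∃ e, D.m - D.r = e + 1 := ⟨D.m - D.r - 1, by omega⟩
      exact ⟨-(D.p : ℤ) ^ e, 1, by rw [k, he]; push_cast; ring⟩
    have h1 := (D.pow_dvd_k_pow_sub_one_iff t).mp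
      (hk.dvd_of_dvd_mul_left (by rwa [mul_sub, mul_one, ← pow_succ']))
    have h2 := Int.natCast_dvd_natCast.mpr h1
    push_cast at h2 ⊢
    simpa using h2

/-- The shape of the automorphisms of `G`. -/
lemma mulAut_shape (φ : MulAut D.G) (hmn : D.m ≤ D.n) : ∃ (i : ℤ) (j : ℕ) (s : ℤ) (t : ℕ),
    φ D.x = D.x ^ i * D.y ^ j ∧ φ D.y = D.x ^ s * D.y ^ t ∧
    D.p ^ (D.n - D.m + D.r) ∣ j ∧ (D.p : ℤ) ^ D.r ∣ t - 1 := by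
  obtain ⟨i, j, hx⟩ := D.exists_normal_form (φ D.x)
  obtain ⟨s, t, hy⟩ := D.exists_normal_form (φ D.y)
  have hr := D.r_lt_m
  have hr1 := D.one_le_r
  have hp := D.prime_p
  have hrel : φ D.y * φ D.x = φ D.x ^ D.k * φ D.y := by
    rw [← map_pow, ← map_mul, ← map_mul, k, ← y_x, inv_mul_cancel_right]
  -- Projecting the relation to `⟨y⟩` leaves `p ^ (m - r) * j ≡ 0` modulo `p ^ n`.
  have hj : D.p ^ (D.n - D.m + D.r) ∣ j := by
    have h1 := congrArg D.toY hrel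
    rw [map_mul, map_mul, mul_comm, mul_left_inj, map_pow, k, pow_add, pow_one,
      left_eq_mul, hx, ← zpow_natCast D.y, toY_eq, ← ofAdd_nsmul, ofAdd_eq_one, nsmul_eq_mul] at h1
    have h2 : D.p ^ D.n ∣ D.p ^ (D.m - D.r) * j := by
      rw [← ZMod.natCast_eq_zero_iff]; exact_mod_cast h1
    rw [show D.n = (D.m - D.r) + (D.n - D.m + D.r) by omega, pow_add] at h2
    exact Nat.dvd_of_mul_dvd_mul_left (pow_pos hp.pos _) h2
  have hjr : D.p ^ D.r ∣ j := (pow_dvd_pow _ (by omega)).trans hj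
  have hcomm : ∀ c : ℤ, D.y ^ j * D.x ^ c = D.x ^ c * D.y ^ j := by
    intro c
    rw [y_pow_mul_x_zpow]
    congr 1
    apply D.zpow_x_eq
    have := ((D.pow_dvd_k_pow_sub_one_iff j).mpr hjr).mul_left c
    rwa [mul_sub, mul_one] at this
  have hpow : ∀ l : ℕ, φ D.x ^ l = D.x ^ (i * l) * D.y ^ (j * l) := by
    intro l
    rw [hx, Commute.mul_pow (hcomm i).symm, zpow_mul, zpow_natCast, pow_mul]
  -- Otherwise `φ(x) ^ p ^ (m - 1) = 1`, although `x` has order `p ^ m`; the `y`-part dies because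
  -- `r ≥ 1`.
  have hi : ¬ (D.p : ℤ) ∣ i := by
    rintro ⟨c, rfl⟩
    have h1 := hpow (D.p ^ (D.m - 1))
    have h2 : D.x ^ ((D.p : ℤ) * c * (D.p ^ (D.m - 1) : ℕ)) = 1 := by
      rw [x_zpow_eq_one_iff]
      refine ⟨c, ?_⟩
      obtain ⟨e, he⟩ : ∃ e, D.m = e + 1 := ⟨D.m - 1, by omega⟩
      rw [he]; push_cast; ring
    have h3 : D.y ^ (j * D.p ^ (D.m - 1)) = 1 := by
      have h4 : D.p ^ D.n ∣ j * D.p ^ (D.m - 1) := by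
        refine (pow_dvd_pow D.p (?_ : D.n ≤ (D.n - D.m + D.r) + (D.m - 1))).trans ?_
        · omega
        · rw [pow_add]; exact mul_dvd_mul_right hj _
      obtain ⟨f, hf⟩ := h4
      rw [hf, pow_mul, y_pow, one_pow]
    rw [h2, h3, mul_one, ← map_pow, MulEquiv.map_eq_one_iff, ← zpow_natCast,
      x_zpow_eq_one_iff] at h1
    have h5 : D.p ^ D.m ∣ D.p ^ (D.m - 1) := by exact_mod_cast h1
    have := (Nat.pow_dvd_pow_iff_le_right hp.one_lt).mp h5
    omega
  -- Since `y ^ j` is central and `y ^ (j k) = y ^ j`, the relation reduces to `i k ^ t ≡ i k`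
  -- modulo `p ^ m`, and `i` is a unit.
  have ht : (D.p : ℤ) ^ D.m ∣ (D.k : ℤ) ^ t - D.k := by
    have hyj : D.y ^ (j * D.k) = D.y ^ j := by
      have h4 : D.p ^ D.n ∣ j * D.p ^ (D.m - D.r) := by
        have h := mul_dvd_mul_right hj (D.p ^ (D.m - D.r))
        rwa [← pow_add, show D.n - D.m + D.r + (D.m - D.r) = D.n by omega] at h
      obtain ⟨f, hf⟩ := h4
      rw [k, mul_add, mul_one, pow_add, hf, pow_mul, y_pow, one_pow, mul_one]
    have hcy : ∀ g : D.G, D.y ^ j * g = g * D.y ^ j := by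
      intro g
      obtain ⟨e, f, rfl⟩ := D.exists_normal_form g
      rw [← mul_assoc, hcomm, mul_assoc, mul_assoc, ← pow_add, ← pow_add, add_comm]
    have hL : φ D.y * φ D.x = D.x ^ (s + i * (D.k : ℤ) ^ t) * (D.y ^ t * D.y ^ j) := by
      rw [hx, hy, mul_assoc, ← mul_assoc (D.y ^ t), y_pow_mul_x_zpow, zpow_add]
      group
    have hR : φ D.x ^ D.k * φ D.y = D.x ^ (i * D.k + s) * (D.y ^ t * D.y ^ j) := by
      rw [hpow, hyj, hy, mul_assoc, hcy, zpow_add]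
      group
    rw [hL, hR] at hrel
    have h1 := mul_right_cancel hrel
    rw [← mul_inv_eq_one, ← zpow_neg, ← zpow_add, x_zpow_eq_one_iff] at h1
    have hcop : IsCoprime ((D.p : ℤ) ^ D.m) i :=
      ((Nat.prime_iff_prime_int.mp hp).coprime_iff_not_dvd.mpr hi).pow_left
    refine hcop.dvd_of_dvd_mul_left (?_ : _ ∣ i * _)
    convert h1 using 1
    ring
  exact ⟨i, j, s, t, hx, hy, hj, D.pow_r_dvd_sub_one ht⟩

end MetacyclicData

/-- For `b ≤ a` the difference is `v ^ b` times the sum of length `a - b`, and `v` is prime to `p`.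
This makes `π'_v` both well defined and injective. -/
lemma pow_dvd_geomS_sub_iff {p : ℕ} (hp : p.Prime) (ho : Odd p) {v : ℤ} (hv : (p : ℤ) ∣ v - 1)
    (s a b : ℕ) : (p : ℤ) ^ s ∣ geomS v a - geomS v b ↔ (p : ℤ) ^ s ∣ a - b := by
  wlog hab : b ≤ a generalizing a b
  · rw [← dvd_neg, neg_sub, this b a (by omega), ← dvd_neg, neg_sub]
  obtain ⟨c, rfl⟩ := Nat.exists_eq_add_of_le hab
  have hpZ := Nat.prime_iff_prime_int.mp hp
  have hpv : ¬ (p : ℤ) ∣ v := fun h => hpZ.not_dvd_one (by simpa using dvd_sub h hv)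
  have hcop : IsCoprime ((p : ℤ) ^ s) (v ^ b) :=
    IsCoprime.pow (hpZ.coprime_iff_not_dvd.mpr hpv)
  rw [geomS_add, add_sub_cancel_left, (⟨hcop.dvd_of_dvd_mul_left, fun h => h.mul_left _⟩ :
    (p : ℤ) ^ s ∣ v ^ b * geomS v c ↔ (p : ℤ) ^ s ∣ geomS v c), pow_dvd_geomS_iff hp ho hv]
  push_cast
  rw [add_sub_cancel_left, ← Nat.cast_pow, Int.natCast_dvd_natCast]

/-! ### Admissibility of `(0, 0, d)` -/

namespace MetacyclicData

variable (D : MetacyclicData)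

lemma p_dvd_of_pow_m_dvd {z : ℤ} (h : (D.p : ℤ) ^ D.m ∣ z) : (D.p : ℤ) ∣ z :=
  (dvd_pow_self _ (by have := D.two_le_m; omega)).trans h

/-- `ṽ ^ p ^ r ≡ 1` modulo `p ^ n`, as `r + max {n - 2 r, 0} + r ≥ n`. -/
lemma deltaT_pow_eq_one : D.deltaT ^ D.p ^ D.r = 1 := by
  apply D.mulAut_ext
  · have := D.deltaT_zpow_x (D.p ^ D.r : ℕ)
    rwa [zpow_natCast] at this
  · have h := D.deltaT_zpow_y (d := (D.p ^ D.r : ℕ)) (v := 1) (by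
      rw [zpowMod_natCast, eq_comm, ← Int.cast_pow, ZMod.intCast_eq_intCast_iff_dvd_sub, vT,
        ← pow_mul, ← pow_add, ← dvd_neg, neg_sub]
      have h1 := D.dvd_pow_sub_one (z := 1 + (D.p : ℤ) ^ D.r) D.one_le_r (by simp)
        (D.n - 2 * D.r + D.r)
      push_cast
      exact (pow_dvd_pow _ (by omega)).trans h1)
    rw [zpow_natCast, zpow_one] at h
    exact h

lemma zpow_deltaT_pow_eq {d : ℤ} {a b : ℕ} (h : (D.p : ℤ) ^ D.r ∣ (a : ℤ) - b) :
    (D.deltaT ^ d) ^ a = (D.deltaT ^ d) ^ b := by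
  have h1 : (D.deltaT ^ d) ^ D.p ^ D.r = 1 := by
    rw [← zpow_natCast, ← zpow_mul, mul_comm, zpow_mul, zpow_natCast, deltaT_pow_eq_one, one_zpow]
  have h2 : b ≡ a [MOD D.p ^ D.r] := Nat.modEq_iff_dvd.mpr (by exact_mod_cast h)
  exact pow_eq_pow_iff_modEq.mpr (h2.symm.of_dvd (orderOf_dvd_of_pow_eq_one h1))

/-- `Γ` kills `x` and has cyclic image, so homomorphism and antihomomorphism coincide. It is
unchanged by precomposition with `φ`, because `p ^ r` divides both `j` and `t - 1`; equivariance
then amounts to `ψ` being central. -/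
theorem admissible_zero_zero (hmn : D.m ≤ D.n) {d : ℤ}
    (hd : zpowMod (D.p ^ D.m) D.vT d = 1) : D.Admissible 0 0 d := by
  obtain ⟨v, hv⟩ := ZMod.intCast_surjective (zpowMod (D.p ^ D.n) D.vT d)
  have hv1 := D.pow_dvd_sub_one_of_zpowMod hmn hv hd
  have hψx := D.deltaT_zpow_x d
  have hψy := D.deltaT_zpow_y hv
  have hψpow := @zpow_deltaT_pow_eq D d
  set ψ := D.deltaT ^ d
  let F : D.G →* MulAut D.G := PresentedGroup.toGroup (f := ![1, ψ]) (by
    intro s hs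
    simp only [rels, Set.mem_insert_iff, Set.mem_singleton_iff] at hs
    rcases hs with rfl | rfl | rfl
    · simp
    · simp only [map_pow, FreeGroup.lift_apply_of, Matrix.cons_val_one, Matrix.cons_val_fin_one]
      rw [hψpow (b := 0), pow_zero]
      push_cast
      rw [sub_zero]
      exact pow_dvd_pow _ D.r_le_n
    · simp)
  have hFx : F D.x = 1 := by simp [F, x]
  have hFy : F D.y = ψ := by simp [F, y]
  have hF : ∀ (i : ℤ) (j : ℕ), F (D.x ^ i * D.y ^ j) = ψ ^ j := by
    intro i j
    rw [map_mul, map_zpow, map_pow, hFx, hFy, one_zpow, one_mul]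
  refine ⟨F, by simp [hFx], by simp [hFy, ψ], ?_, ?_⟩
  · intro σ τ
    obtain ⟨i, j, rfl⟩ := D.exists_normal_form σ
    obtain ⟨i', j', rfl⟩ := D.exists_normal_form τ
    rw [map_mul, hF, hF, ← pow_add, ← pow_add, add_comm]
  · intro φ
    obtain ⟨i, j, s, t, hx, hy, hj, ht⟩ := D.mulAut_shape φ hmn
    -- At `x` this needs `p ^ n ∣ j (v - 1)`, which follows from `m + (n - m + r) ≥ n`; at `y` it is
    -- `(x^s y^t)^v = x^s y^(t v)`.
    have hcomm : φ * ψ = ψ * φ := by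
      apply D.mulAut_ext
      · rw [MulAut.mul_apply, MulAut.mul_apply, hψx, hx, map_mul, map_zpow, map_pow, hψx, hψy,
          ← zpow_natCast, ← zpow_natCast, ← zpow_mul]
        congr 1
        apply D.zpow_y_eq
        have h1 : (D.p : ℤ) ^ D.n ∣ (D.p : ℤ) ^ D.m * (D.p : ℤ) ^ (D.n - D.m + D.r) := by
          rw [← pow_add]; exact pow_dvd_pow _ (by omega)
        have h2 : (D.p : ℤ) ^ (D.n - D.m + D.r) ∣ (j : ℤ) := by exact_mod_cast hj
        have h3 := (h1.trans (mul_dvd_mul hv1 h2))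
        rw [← dvd_neg]
        convert h3 using 1
        ring
      · rw [MulAut.mul_apply, MulAut.mul_apply, hψy, map_zpow, hy, D.x_y_zpow_of_dvd s t hv1,
          map_mul, map_zpow, map_pow, hψx, hψy, ← zpow_natCast, ← zpow_mul, mul_comm v]
    have key : F.comp φ.toMonoidHom = (MulAut.conj φ).toMonoidHom.comp F := by
      apply PresentedGroup.ext
      intro l
      fin_cases l
      · change F (φ D.x) = φ * F D.x * φ⁻¹
        have h2 : (D.p : ℤ) ^ D.r ∣ (j : ℤ) := by
          refine (pow_dvd_pow _ (by omega)).trans (?_ : (D.p : ℤ) ^ (D.n - D.m + D.r) ∣ (j : ℤ))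
          exact_mod_cast hj
        rw [hx, hF, hFx, hψpow (b := 0) (by simpa using h2)]
        simp
      · change F (φ D.y) = φ * F D.y * φ⁻¹
        rw [hy, hF, hFy, hψpow (b := 1) (by simpa using ht), pow_one, hcomm, mul_inv_cancel_right]
    exact fun σ => DFunLike.congr_fun key σ

/-! ### The maps `π'_v`, `φ` and the powers of `Φ_y` -/

/-- `π'_v` is a well-defined bijection. -/
lemma exists_isPi' {v : ℤ} (hv : (D.p : ℤ) ∣ v - 1) : ∃ f, D.IsPi' v f := by
  choose i j hij using D.exists_normal_form
  let f : D.G → D.G := fun g => D.x ^ i g * D.y ^ geomS v (j g)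
  have hiff : ∀ g g', f g = f g' ↔ g = g' := by
    intro g g'
    conv_rhs => rw [hij g, hij g', ← zpow_natCast, ← zpow_natCast D.y]
    rw [normal_form_eq_iff, normal_form_eq_iff, pow_dvd_geomS_sub_iff D.prime_p D.odd_p hv]
  have hbij : Function.Bijective f :=
    Finite.injective_iff_bijective.mp fun g g' h => (hiff g g').mp h
  refine ⟨Equiv.ofBijective f hbij, fun a b => ?_⟩
  -- The chosen exponents agree with `a`, `b` only modulo `p ^ m`, `p ^ n`; the geometric sum
  -- respects the latter congruence.
  have h := hij (D.x ^ a * D.y ^ b)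
  rw [← zpow_natCast, ← zpow_natCast D.y, normal_form_eq_iff,
    ← pow_dvd_geomS_sub_iff D.prime_p D.odd_p hv, ← normal_form_eq_iff] at h
  rw [Equiv.ofBijective_apply, h, zpow_natCast]

/-- The automorphism `x ↦ x`, `y ↦ y ^ j`, for `j ≡ 1` modulo `p ^ r`. -/
lemma exists_mulAut_y_pow {j : ℕ} (hj : (D.p : ℤ) ^ D.r ∣ j - 1) :
    ∃ φ : MulAut D.G, φ D.x = D.x ∧ φ D.y = D.y ^ j := by
  have hx : D.deltaHom j hj D.x = D.x := D.homOf_x _ _ _ _ _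
  have hy : D.deltaHom j hj D.y = D.y ^ j := D.homOf_y _ _ _ _ _
  -- As `j ≡ 1` mod `p`, it has an inverse `a` modulo `p ^ n`, and `y ^ a` is a preimage of `y`.
  have hsurj : Function.Surjective (D.deltaHom j hj) := by
    obtain ⟨c, hc⟩ := hj
    have hcop : IsCoprime (j : ℤ) ((D.p : ℤ) ^ D.n) := by
      refine IsCoprime.pow_right ?_
      obtain ⟨e, he⟩ : ∃ e, D.r = e + 1 := ⟨D.r - 1, by have := D.one_le_r; omega⟩
      rw [he] at hc
      exact ⟨1, -(D.p : ℤ) ^ e * c, by linear_combination hc⟩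
    obtain ⟨a, b, hab⟩ := hcop
    intro g
    obtain ⟨i, l, rfl⟩ := D.exists_normal_form g
    refine ⟨D.x ^ i * (D.y ^ a) ^ l, ?_⟩
    rw [map_mul, map_pow, map_zpow, map_zpow, hx, hy, ← zpow_natCast D.y, ← zpow_mul,
      D.zpow_y_eq (a := j * a) (b := 1) ⟨-b, by linear_combination hab⟩, zpow_one]
  exact ⟨MulEquiv.ofBijective (D.deltaHom j hj) (Finite.surjective_iff_bijective.mp hsurj), hx, hy⟩

lemma rho_zpow_apply (σ τ : D.G) (i : ℤ) : (D.rho σ ^ i) τ = τ * σ ^ (-i) := by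
  simp [rho]

/-- Iterating `τ ↦ δ̃^d(τ) y⁻¹` accumulates the geometric sum; since `Φ_y ^ p ^ n = 1`, integer
exponents reduce to natural ones. -/
lemma PhiY_zpow_one {d v : ℤ} {a : ℤ} (ha : D.alphaT ^ a = 1)
    (hv : (v : ZMod (D.p ^ D.n)) = zpowMod (D.p ^ D.n) D.vT d) (hv1 : (D.p : ℤ) ^ D.m ∣ v - 1)
    {l : ℤ} {l' : ℕ} (hl : (D.p : ℤ) ^ D.n ∣ l - l') :
    (D.PhiY a d ^ l) 1 = (D.y ^ geomS v l')⁻¹ := by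
  have hΦ : ∀ τ, D.PhiY a d τ = (D.deltaT ^ d) τ * D.y⁻¹ := by
    intro τ
    rw [PhiY, ha, one_mul]
    rfl
  have hpow : ∀ (l : ℕ) (τ : D.G), (D.PhiY a d ^ l) τ =
      ((D.deltaT ^ d) ^ l) τ * (D.y ^ geomS v l)⁻¹ := by
    intro l τ
    induction l with
    | zero => simp [geomS]
    | succ l ih =>
      rw [pow_succ', Equiv.Perm.mul_apply, ih, hΦ, map_mul, map_inv, map_zpow,
        D.deltaT_zpow_y hv, geomS_succ', pow_succ', MulAut.mul_apply, ← zpow_mul, zpow_add]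
      group
  have hN : D.PhiY a d ^ D.p ^ D.n = 1 := by
    ext τ
    have h1 : (D.p : ℤ) ^ D.n ∣ geomS v (D.p ^ D.n) := D.pow_dvd_geomS (D.p_dvd_of_pow_m_dvd hv1) _
    rw [hpow, D.zpow_deltaT_pow_eq (b := 0), D.zpow_y_eq (b := 0) (by simpa using h1)]
    · simp
    · push_cast
      rw [sub_zero]
      exact pow_dvd_pow _ D.r_le_n
  obtain ⟨c, hc⟩ := hl
  obtain rfl : l = l' + (D.p ^ D.n : ℕ) * c := by push_cast; linarith
  rw [zpow_add, zpow_mul, zpow_natCast, zpow_natCast, hN, one_zpow, mul_one, hpow, map_one, one_mul]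

/-! ### Counting the classes -/

lemma zpowMod_vT_eq_one_iff (d : ℤ) : zpowMod (D.p ^ D.m) D.vT d = 1 ↔
    (D.p : ℤ) ^ (D.m - D.r - (D.n - 2 * D.r)) ∣ d := by
  have hr := D.r_lt_m
  have h := pow_dvd_one_add_pow_sub_one_iff D.prime_p D.odd_p D.one_le_r (D.m - D.r)
    (D.p ^ (D.n - 2 * D.r) * d.natAbs)
  rw [Nat.add_sub_cancel' hr.le] at h
  rw [zpowMod_eq_one_iff (D.isCoprime_vT _), vT, ← pow_mul, Nat.cast_pow, h, ← Nat.cast_pow,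
    Int.natCast_dvd]
  rcases le_total (D.m - D.r) (D.n - 2 * D.r) with hle | hle
  · rw [Nat.sub_eq_zero_of_le hle, pow_zero]
    exact ⟨fun _ => one_dvd _, fun _ => (pow_dvd_pow _ hle).mul_right _⟩
  · conv_lhs => rw [← Nat.add_sub_cancel' hle, pow_add]
    exact Nat.mul_dvd_mul_iff_left (pow_pos D.prime_p.pos _)

theorem ncard_classes (hmn : D.m ≤ D.n) :
    {c | ∃ a d : ℤ, D.Admissible a 0 d ∧ zpowMod (D.p ^ D.m) D.vT d = 1 ∧
        c = D.classModM a 0 d}.ncard = D.p ^ min D.r (D.n - D.m) := by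
  have hr := D.r_lt_m
  set e := D.m - D.r - (D.n - 2 * D.r) with he
  set f := min D.r (D.n - D.m) with hf
  -- For `n ≥ 2 r` both sides are `r`; otherwise `e = m - r` and `f = n - m`. So the multiples of `p
  -- ^ e` form `p ^ f` classes.
  have hef : min D.r (D.n - D.r) = e + f := by omega
  have hpf : 0 < D.p ^ f := pow_pos D.prime_p.pos _
  have hset : {c | ∃ a d : ℤ, D.Admissible a 0 d ∧ zpowMod (D.p ^ D.m) D.vT d = 1 ∧
      c = D.classModM a 0 d} =
      (fun t : ℕ => D.classModM 0 0 ((D.p : ℤ) ^ e * t)) '' (Finset.range (D.p ^ f) : Set ℕ) := by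
    ext c
    constructor
    · rintro ⟨a, d, hadm, hd, rfl⟩
      have ha := D.pow_r_dvd_of_zpowMod_uT (D.zpowMod_uT_of_admissible hmn hadm hd)
      obtain ⟨d', rfl⟩ := (D.zpowMod_vT_eq_one_iff d).mp hd
      have hpf' : (0 : ℤ) < (D.p ^ f : ℕ) := by exact_mod_cast hpf
      have h0 : ((d' % (D.p ^ f : ℕ)).toNat : ℤ) = d' % (D.p ^ f : ℕ) :=
        Int.toNat_of_nonneg (Int.emod_nonneg _ hpf'.ne')
      refine ⟨(d' % (D.p ^ f : ℕ)).toNat, ?_, ?_⟩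
      · have := Int.emod_lt_of_pos d' hpf'
        simp only [Finset.coe_range, Set.mem_Iio]
        omega
      · simp only [classModM, Prod.mk.injEq, true_and, ZMod.intCast_eq_intCast_iff_dvd_sub]
        refine ⟨by simpa using ha, ?_⟩
        rw [h0, hef, ← he, ← mul_sub, pow_add]
        push_cast
        refine mul_dvd_mul_left _ ?_
        have := Int.dvd_sub_self_of_emod_eq (a := d') (b := (D.p ^ f : ℕ)) rfl
        rw [← dvd_neg, neg_sub]
        exact_mod_cast this
    · rintro ⟨t, -, rfl⟩
      have hd := (D.zpowMod_vT_eq_one_iff ((D.p : ℤ) ^ e * t)).mpr (dvd_mul_right _ _)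
      exact ⟨0, _, D.admissible_zero_zero hmn hd, hd, rfl⟩
  rw [hset, Set.InjOn.ncard_image, Set.ncard_coe_finset, Finset.card_range]
  intro t ht t' ht' h
  simp only [Finset.coe_range, Set.mem_Iio] at ht ht'
  simp only [classModM, Prod.mk.injEq, true_and, ZMod.intCast_eq_intCast_iff_dvd_sub] at h
  rw [hef, ← mul_sub, pow_add] at h
  push_cast at h
  have h1 := Int.dvd_of_mul_dvd_mul_left
    (pow_ne_zero e (by exact_mod_cast D.prime_p.ne_zero : (D.p : ℤ) ≠ 0)) h
  exact Nat.ModEq.eq_of_lt_of_lt (Nat.modEq_iff_dvd.mpr (by exact_mod_cast h1)) ht ht'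

/-! ### The criterion, the exponent `j₀` and the conclusion -/

lemma isoCriterion_of_zpowMod_uT {a : ℤ} (h : zpowMod (D.p ^ D.m) D.uT a = 1) :
    D.IsoCriterion a 0 := by
  have hr := D.r_lt_m
  have hr1 := D.one_le_r
  have h1 : zpowMod (D.p ^ (D.m - D.r + 1)) D.uT a = 1 := by
    have := intCast_eq_zpowMod_of_dvd (pow_dvd_pow D.p (by omega : D.m - D.r + 1 ≤ D.m))
      D.isCoprime_uT (v := 1) (by rw [h, Int.cast_one])
    rw [← this, Int.cast_one]
  intro h2
  rw [h1, one_mul, sub_zero, one_mul,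
    ← Int.cast_one (R := ZMod (D.p ^ (D.m - D.r + 1))), eq_comm,
    ZMod.intCast_eq_intCast_iff_dvd_sub, add_sub_cancel_left] at h2
  have h3 : D.p ^ (D.m - D.r + 1) ∣ D.p ^ (D.m - D.r) := by exact_mod_cast h2
  have := (Nat.pow_dvd_pow_iff_le_right D.prime_p.one_lt).mp h3
  omega

/-- With `ũ ^ a` trivial, the condition on `j` becomes `k ^ j ≡ k` modulo `p ^ m`. -/
lemma pow_r_dvd_of_isJ {a : ℤ} (h : zpowMod (D.p ^ D.m) D.uT a = 1) {j : ℕ} (hj : D.IsJ a 0 j) :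
    (D.p : ℤ) ^ D.r ∣ j - 1 := by
  have h1 := hj.2
  rw [h, one_mul, sub_zero, one_mul, ← Int.cast_pow, eq_comm,
    ZMod.intCast_eq_intCast_iff_dvd_sub] at h1
  apply D.pow_r_dvd_sub_one
  rw [k]
  exact_mod_cast h1

end MetacyclicData

theorem proposition5p3 (D : MetacyclicData) (hmn : D.m ≤ D.n) :
    {c | ∃ a d : ℤ, D.Admissible a 0 d ∧ zpowMod (D.p ^ D.m) D.vT d = 1 ∧
        c = D.classModM a 0 d}.ncard = D.p ^ min D.r (D.n - D.m) ∧
    ∀ a d : ℤ, D.Admissible a 0 d → zpowMod (D.p ^ D.m) D.vT d = 1 →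
      D.IsoCriterion a 0 ∧
      (∃ j₀ : ℕ, D.IsJ a 0 j₀) ∧
      ∀ j₀ : ℕ, D.IsJ a 0 j₀ →
        ∀ v : ℤ, (v : ZMod (D.p ^ D.n)) = zpowMod (D.p ^ D.n) D.vT d →
          ∃ π π' : Equiv.Perm D.G, D.IsPi a 0 d j₀ π ∧ D.IsPi' v π' ∧
            D.EqModAut (Equiv.inv D.G * π) π' := by
  refine ⟨D.ncard_classes hmn, fun a d hadm hd => ?_⟩
  have hU := D.zpowMod_uT_of_admissible hmn hadm hd
  refine ⟨D.isoCriterion_of_zpowMod_uT hU, ⟨1, Nat.coprime_one_left _, by simp [hU]⟩, ?_⟩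
  intro j₀ hj₀ v hv
  have hv1 := D.pow_dvd_sub_one_of_zpowMod hmn hv hd
  obtain ⟨π', hπ'⟩ := D.exists_isPi' (D.p_dvd_of_pow_m_dvd hv1)
  obtain ⟨φ, hφx, hφy⟩ := D.exists_mulAut_y_pow (D.pow_r_dvd_of_isJ hU hj₀)
  -- Taking `π` to be `ι ∘ π'_v ∘ φ` makes it a bijection from the start; only its defining formula
  -- remains to be checked.
  refine ⟨Equiv.inv D.G * (π' * MulAut.toPerm D.G φ), π', ?_, hπ', φ, ?_⟩
  · intro i j
    -- The geometric sum needs a natural length, so `j` is replaced by its residue modulo `p ^ n`.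
    obtain ⟨l, hl⟩ : ∃ l : ℕ, (D.p : ℤ) ^ D.n ∣ j - l := by
      have hpos : (0 : ℤ) < (D.p : ℤ) ^ D.n := by
        have := D.prime_p.pos
        positivity
      refine ⟨(j % (D.p : ℤ) ^ D.n).toNat, ?_⟩
      rw [Int.toNat_of_nonneg (Int.emod_nonneg _ hpos.ne')]
      exact Int.dvd_self_sub_emod
    have hl' : (D.p : ℤ) ^ D.n ∣ (j₀ : ℤ) * j - (j₀ * l : ℕ) := by
      push_cast
      rw [← mul_sub]
      exact hl.mul_left _
    have h1 : φ (D.x ^ i * D.y ^ j) = D.x ^ i * D.y ^ (j₀ * l) := by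
      rw [map_mul, map_zpow, map_zpow, hφx, hφy, ← zpow_natCast, ← zpow_mul, D.zpow_y_eq hl',
        zpow_natCast]
    have h2 : (D.PhiX 0 ^ i) = D.rho D.x ^ i := by
      rw [MetacyclicData.PhiX, zpow_zero, map_one, mul_one]
    rw [Equiv.Perm.mul_apply, Equiv.Perm.mul_apply, Equiv.Perm.mul_apply, h2,
      D.PhiY_zpow_one (D.alphaT_zpow_eq_one hU) hv hv1 hl', D.rho_zpow_apply]
    change (π' (φ (D.x ^ i * D.y ^ j)))⁻¹ = _
    rw [h1, hπ', mul_inv_rev, zpow_neg]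
  · ext g
    simp
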